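/- Let $\Bbbk$ be an algebraically closed field of characteristic $p$, and let $H$ be a finite-dimensional semisimple Hopf algebra over $\Bbbk$ with counit $\varepsilon$ and antipode $S$, such that $p>(\dim_{\Bbbk}H)^{1/2}$. Let $\Lambda\in H$ be a nonzero left integral, i.e. $h\Lambda=\varepsilon(h)\Lambda$ for all $h\in H$, and put $\mathbf{u}=S(\Lambda_{(2)})\Lambda_{(1)}$ (Sweedler notation). For $n\in\mathbb{Z}$ let $P_n:H\to H$ be the $n$-th Sweedler power map: $P_n(a)=a_{(1)}\cdots a_{(n)}$ for $n\ge 1$, $P_0(a)=\varepsilon(a)1$, and $P_n(a)=S(a_{(1)})\cdots S(a_{(-n)})$ for $n\le -1$. Then $\mathbf{u}$ is invertible in $H$, and for every finite-dimensional representation $V$ of $H$, with character $\chi_V(h)=\mathrm{tr}(h|_V)$ and $n$-th Frobenius–Schur indicator $$\nu_n(V)=\chi_V\bigl(\mathbf{u}^{-1}P_n(\Lambda)\bigr),$$ and every $n\in\mathbb{Z}$, we have $$\nu_n(V)=\nu_n(V^*),$$ where $V^*$ is the dual representation $(h\cdot f)(v)=f(S(h)v)$ for $h\in H$, $f\in V^*$,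 $v\in V$. -/

import Mathlib

noncomputable section

namespace HopfIndicator

variable {k H V : Type*} [Field k] [Ring H] [HopfAlgebra k H] [AddCommGroup V] [Module k V]

/-- `Λ` is a left integral of the Hopf algebra `H`: `h Λ = ε(h) Λ` for all `h ∈ H`. -/
def IsLeftIntegral (k : Type*) {H : Type*} [Field k] [Ring H] [HopfAlgebra k H] (Λ : H) : Prop :=
  ∀ h : H, h * Λ = (Coalgebra.counit (R := k) h) • Λ

/-- The element `𝐮 = S(Λ₍₂₎) Λ₍₁₎`. -/
def uElement (k : Type*) {H : Type*} [Field k] [Ring H] [HopfAlgebra k H] (Λ : H) : H :=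
  LinearMap.mul' k H
    ((HopfAlgebra.antipode k).rTensor H (TensorProduct.comm k H H (Coalgebra.comul (R := k) Λ)))

/-- The `n`-th Sweedler power map `P_n`. The power is taken for the convolution product
`(f * g)(a) = f(a₍₁₎) g(a₍₂₎)` with unit `a ↦ ε(a) 1`, so that `P_n(a) = a₍₁₎ ⋯ a₍ₙ₎` for `n ≥ 1`,
`P_0(a) = ε(a) 1` and `P_n(a) = S(a₍₁₎) ⋯ S(a₍₋ₙ₎)` for `n ≤ -1`. -/
def sweedlerPower (k H : Type*) [Field k] [Ring H] [HopfAlgebra k H] : ℤ → (H →ₗ[k] H)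
  | Int.ofNat m => (WithConv.toConv (LinearMap.id : H →ₗ[k] H) ^ m).ofConv
  | Int.negSucc m => (WithConv.toConv (HopfAlgebra.antipode k : H →ₗ[k] H) ^ (m + 1)).ofConv

/-- The character `χ_V(h) = tr(ρ_V(h))` of a representation. -/
def character (ρ : H →ₐ[k] Module.End k V) : H →ₗ[k] k :=
  LinearMap.trace k V ∘ₗ ρ.toLinearMap

/-- The dual representation on `V^*`: `(h · f)(v) = f(S(h) · v)`. -/
def dualRep (ρ : H →ₐ[k] Module.End k V) : H →ₐ[k] Module.End k (Module.Dual k V) :=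
  AlgHom.ofLinearMap
    (Module.Dual.transpose ∘ₗ ρ.toLinearMap ∘ₗ HopfAlgebra.antipode k)
    (by ext f v; simp [Module.Dual.transpose_apply])
    (by
      intro a b
      ext f v
      simp [Module.Dual.transpose_apply, HopfAlgebra.antipode_mul_antidistrib])

theorem dualRep_apply (ρ : H →ₐ[k] Module.End k V) (h : H) (f : Module.Dual k V) (v : V) :
    dualRep ρ h f v = f (ρ (HopfAlgebra.antipode k h) v) := rfl

/-- The `n`-th Frobenius-Schur indicator `ν_n(V) = χ_V(𝐮⁻¹ P_n(Λ))`, where `𝐮 = S(Λ₍₂₎) Λ₍₁₎`.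
`Ring.inverse` is the two-sided inverse whenever `𝐮` is a unit. -/
def fsIndicator (Λ : H) (ρ : H →ₐ[k] Module.End k V) (n : ℤ) : k :=
  character ρ (Ring.inverse (uElement k Λ) * sweedlerPower k H n Λ)

end HopfIndicator

end

/-!
The nonzero left integral `Λ` of the semisimple Hopf algebra `H` is two-sided and satisfies
`ε(Λ) ≠ 0`, since otherwise the ideal spanned by `Λ` would contain no nonzero idempotent.
Being a right integral, `Λ` satisfies `Λ₍₁₎ h ⊗ Λ₍₂₎ = Λ₍₁₎ ⊗ Λ₍₂₎ S(h)`, which gives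
`𝐮 h = S²(h) 𝐮` (`uElement_mul`).

*Invertibility of `𝐮`* (`isUnit_uElement`). By the twisted commutation the kernel of left
multiplication by `𝐮` is a left ideal. A simple left ideal `I` inside it would give
`0 = tr(𝐮|_I) = tr(Λ₍₁₎ S(Λ₍₂₎)|_I) = ε(Λ) dim I`. But `(dim I)² ≤ dim H` by the density theorem,
so `0 < dim I < p` and the right-hand side is nonzero in the field. Hence `𝐮` is invertible, `S²` is
conjugation by `𝐮`, `S` is bijective, and `S(Λ) = Λ` by uniqueness of integrals.

*Indicators.* From `S(Λ) = Λ` one gets `S(P_n(Λ)) = P_n(Λ)`, so that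
`ν_n(V^*) = χ_V(S(𝐮⁻¹ P_n(Λ))) = χ_V(S(𝐮)⁻¹ P_n(Λ))`, and it remains to replace `S(𝐮)⁻¹` by `𝐮⁻¹`.
The key identity is `Λ₍₂₎ ⊗ Λ₍₁₎ S(𝐮) = Λ₍₁₎ ⊗ 𝐮 Λ₍₂₎` (`comm_comul_mul`), obtained by evaluating
`Λ₍₂₎ Λ'₍₁₎ ⊗ Λ₍₁₎ Λ'₍₂₎`, with `Λ'` a second copy of `Λ`, in two ways: absorbing the first copy
into the second with the left integral property, or the second into the first with the right
integral property. Writing `P_n = id * Q = Q * id` for the convolution product and using cyclicity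
of the trace,
`χ_V(𝐮⁻¹ Λ₍₁₎ Q(Λ₍₂₎)) = χ_V(𝐮⁻¹ 𝐮 Λ₍₂₎ S(𝐮)⁻¹ Q(Λ₍₁₎)) = χ_V(S(𝐮)⁻¹ Q(Λ₍₁₎) Λ₍₂₎)`
(`character_mul_sweedlerPower_eq`).
-/

namespace HopfIndicator

open TensorProduct WithConv Coalgebra HopfAlgebra

variable {k H V : Type*} [Field k] [Ring H] [HopfAlgebra k H]

/-! ### The antipode as an anti-coalgebra map -/

section Antipode

/-- `a ↦ S(a)` followed by an algebra map `f` is the convolution inverse of `f`. -/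
theorem toConv_algHom_mul_toConv_comp_antipode {A : Type*} [Ring A] [Algebra k A] (f : H →ₐ[k] A) :
    toConv f.toLinearMap * toConv (f.toLinearMap ∘ₗ antipode k) = 1 := by
  have h := LinearMap.algHom_comp_convMul_distrib f (toConv LinearMap.id) (toConv (antipode k))
  rw [LinearMap.id_mul_antipode] at h
  apply ofConv_injective
  refine h.symm.trans ?_
  ext x
  simp [LinearMap.convOne_def]

theorem toConv_comp_antipode_mul_toConv_algHom {A : Type*} [Ring A] [Algebra k A] (f : H →ₐ[k] A) :
    toConv (f.toLinearMap ∘ₗ antipode k) * toConv f.toLinearMap = 1 := by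
  have h := LinearMap.algHom_comp_convMul_distrib f (toConv (antipode k)) (toConv LinearMap.id)
  rw [LinearMap.antipode_mul_id] at h
  apply ofConv_injective
  refine h.symm.trans ?_
  ext x
  simp [LinearMap.convOne_def]

/-- In the convolution algebra `Hom(H, H ⊗ H)`, the comultiplication is the product of the two
inclusions of `H` into `H ⊗ H`. -/
theorem toConv_includeLeft_mul_toConv_includeRight :
    toConv (Algebra.TensorProduct.includeLeft : H →ₐ[k] H ⊗[k] H).toLinearMap *
      toConv (Algebra.TensorProduct.includeRight : H →ₐ[k] H ⊗[k] H).toLinearMap =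
      toConv (Bialgebra.comulAlgHom k H).toLinearMap := by
  ext a
  rw [(ℛ k a).convMul_apply]
  simp [(ℛ k a).eq]

/-- `Δ(S(a)) = S(a₍₂₎) ⊗ S(a₍₁₎)`. Both sides are convolution inverses of `Δ`. -/
theorem comul_antipode (a : H) :
    comul (R := k) (antipode k a) =
      TensorProduct.map (antipode k) (antipode k) (TensorProduct.comm k H H (comul (R := k) a)) := by
  set iL := (Algebra.TensorProduct.includeLeft : H →ₐ[k] H ⊗[k] H)
  set iR := (Algebra.TensorProduct.includeRight : H →ₐ[k] H ⊗[k] H)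
  have h1 : toConv (Bialgebra.comulAlgHom k H).toLinearMap *
      (toConv (iR.toLinearMap ∘ₗ antipode k) * toConv (iL.toLinearMap ∘ₗ antipode k)) = 1 := by
    rw [← toConv_includeLeft_mul_toConv_includeRight, mul_assoc, ← mul_assoc (toConv iR.toLinearMap),
      toConv_algHom_mul_toConv_comp_antipode, one_mul, toConv_algHom_mul_toConv_comp_antipode]
  have h2 := left_inv_eq_right_inv
    (toConv_comp_antipode_mul_toConv_algHom (Bialgebra.comulAlgHom k H)) h1
  have h3 := congr($h2 a)
  rw [(ℛ k a).convMul_apply] at h3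
  conv_rhs => rw [← (ℛ k a).eq]
  simpa [iL, iR] using h3

end Antipode

/-! ### Integrals and the element `𝐮` -/

section Integral

variable {Λ : H}

/-- `Λ₍₁₎ ⊗ h Λ₍₂₎ = S(h) Λ₍₁₎ ⊗ Λ₍₂₎` for a left integral `Λ`. -/
theorem IsLeftIntegral.one_tmul_mul_comul (hΛ : IsLeftIntegral k Λ) (h : H) :
    ((1 : H) ⊗ₜ[k] h) * comul (R := k) Λ = (antipode k h ⊗ₜ[k] (1 : H)) * comul (R := k) Λ := by
  -- `1 ⊗ h = (S(h₍₁₎) ⊗ 1) Δ(h₍₂₎)`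
  have key : toConv ((Algebra.TensorProduct.includeLeft : H →ₐ[k] H ⊗[k] H).toLinearMap ∘ₗ
      antipode k) * toConv (Bialgebra.comulAlgHom k H).toLinearMap =
      toConv (Algebra.TensorProduct.includeRight : H →ₐ[k] H ⊗[k] H).toLinearMap := by
    rw [← toConv_includeLeft_mul_toConv_includeRight, ← mul_assoc,
      toConv_comp_antipode_mul_toConv_algHom, one_mul]
  have h1 := congr($key h)
  rw [(ℛ k h).convMul_apply] at h1
  replace h1 : ∑ i ∈ (ℛ k h).index, (antipode k ((ℛ k h).left i) ⊗ₜ[k] (1 : H)) *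
      comul (R := k) ((ℛ k h).right i) = (1 : H) ⊗ₜ[k] h := by simpa using h1
  have h2 : ∑ i ∈ (ℛ k h).index, counit (R := k) ((ℛ k h).right i) • (ℛ k h).left i = h := by
    simpa [-sum_tmul_counit_eq] using
      congr(TensorProduct.rid k H $(sum_tmul_counit_eq (ℛ k h)))
  rw [← h1, Finset.sum_mul]
  conv_rhs => rw [← h2, map_sum, TensorProduct.sum_tmul, Finset.sum_mul]
  refine Finset.sum_congr rfl fun i _ ↦ ?_
  rw [mul_assoc, ← Bialgebra.comul_mul, hΛ, map_smul, map_smul, mul_smul_comm,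
    ← TensorProduct.smul_tmul', smul_mul_assoc]

/-- `Λ₍₁₎ h ⊗ Λ₍₂₎ = Λ₍₁₎ ⊗ Λ₍₂₎ S(h)` for a right integral `Λ`. -/
theorem comul_mul_tmul_one (hΛ : ∀ h : H, Λ * h = counit (R := k) h • Λ) (h : H) :
    comul (R := k) Λ * (h ⊗ₜ[k] (1 : H)) = comul (R := k) Λ * ((1 : H) ⊗ₜ[k] antipode k h) := by
  -- `h ⊗ 1 = Δ(h₍₁₎) (1 ⊗ S(h₍₂₎))`
  have key : toConv (Bialgebra.comulAlgHom k H).toLinearMap *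
      toConv ((Algebra.TensorProduct.includeRight : H →ₐ[k] H ⊗[k] H).toLinearMap ∘ₗ antipode k) =
      toConv (Algebra.TensorProduct.includeLeft : H →ₐ[k] H ⊗[k] H).toLinearMap := by
    rw [← toConv_includeLeft_mul_toConv_includeRight, mul_assoc,
      toConv_algHom_mul_toConv_comp_antipode, mul_one]
  have h1 := congr($key h)
  rw [(ℛ k h).convMul_apply] at h1
  replace h1 : ∑ i ∈ (ℛ k h).index, comul (R := k) ((ℛ k h).left i) *
      ((1 : H) ⊗ₜ[k] antipode k ((ℛ k h).right i)) = h ⊗ₜ[k] (1 : H) := by simpa using h1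
  conv_rhs => rw [← sum_counit_smul (ℛ k h), map_sum, TensorProduct.tmul_sum, Finset.mul_sum]
  rw [← h1, Finset.mul_sum]
  refine Finset.sum_congr rfl fun i _ ↦ ?_
  rw [← mul_assoc, ← Bialgebra.comul_mul, hΛ, map_smul, map_smul, smul_mul_assoc,
    TensorProduct.tmul_smul, mul_smul_comm]

/-- In a semisimple Hopf algebra, the ideal spanned by a nonzero left integral `Λ` contains a
nonzero idempotent, so `Λ² = ε(Λ) Λ` cannot vanish. -/
theorem IsLeftIntegral.eq_zero_of_counit_eq_zero [IsSemisimpleRing H] (hΛ : IsLeftIntegral k Λ)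
    (h0 : counit (R := k) Λ = 0) : Λ = 0 := by
  obtain ⟨e, he, hspan⟩ := IsSemisimpleRing.ideal_eq_span_idempotent (Ideal.span {Λ})
  obtain ⟨x, hx⟩ := Ideal.mem_span_singleton'.mp
    (hspan ▸ Ideal.mem_span_singleton_self e : e ∈ Ideal.span {Λ})
  obtain ⟨y, hy⟩ := Ideal.mem_span_singleton'.mp
    (hspan ▸ Ideal.mem_span_singleton_self Λ : Λ ∈ Ideal.span {e})
  have he0 : e = 0 := by
    rw [← he.eq, ← hx, hΛ x, smul_mul_smul_comm, hΛ Λ, h0, zero_smul, smul_zero]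
  rw [← hy, he0, mul_zero]

theorem IsLeftIntegral.eq_of_counit_eq [IsSemisimpleRing H] {Λ' : H} (hΛ : IsLeftIntegral k Λ)
    (hΛ' : IsLeftIntegral k Λ') (h : counit (R := k) Λ = counit (R := k) Λ') : Λ = Λ' := by
  refine sub_eq_zero.mp (IsLeftIntegral.eq_zero_of_counit_eq_zero (k := k) (fun x ↦ ?_) ?_)
  · rw [mul_sub, hΛ, hΛ', smul_sub]
  · rw [map_sub, h, sub_self]

/-- A semisimple Hopf algebra is unimodular: its left integrals are right integrals. -/
theorem IsLeftIntegral.mul_eq_counit_smul [IsSemisimpleRing H] (hΛ : IsLeftIntegral k Λ) (h : H) :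
    Λ * h = counit (R := k) h • Λ := by
  refine IsLeftIntegral.eq_of_counit_eq (k := k) (fun x ↦ ?_) (fun x ↦ ?_) ?_
  · rw [← mul_assoc, hΛ, smul_mul_assoc]
  · rw [mul_smul_comm, hΛ, smul_comm]
  · rw [Bialgebra.counit_mul, map_smul, smul_eq_mul, mul_comm]

theorem IsLeftIntegral.antipode_eq [IsSemisimpleRing H] (hΛ : IsLeftIntegral k Λ)
    (hS : Function.Surjective (antipode k : H →ₗ[k] H)) : antipode k Λ = Λ := by
  refine IsLeftIntegral.eq_of_counit_eq (k := k) (fun x ↦ ?_) hΛ (counit_antipode Λ)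
  obtain ⟨y, rfl⟩ := hS x
  rw [← antipode_mul_antidistrib, hΛ.mul_eq_counit_smul, map_smul, counit_antipode]

variable (k H) in
/-- The map `a ⊗ b ↦ S(b) a`, whose value at `Δ(Λ)` is `𝐮`. -/
def antipodeMulSwap : H ⊗[k] H →ₗ[k] H :=
  LinearMap.mul' k H ∘ₗ (antipode k).rTensor H ∘ₗ (TensorProduct.comm k H H).toLinearMap

@[simp]
theorem antipodeMulSwap_tmul (a b : H) :
    antipodeMulSwap k H (a ⊗ₜ[k] b) = antipode k b * a := by
  simp [antipodeMulSwap]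

theorem antipodeMulSwap_comul (Λ : H) :
    antipodeMulSwap k H (comul (R := k) Λ) = uElement k Λ := rfl

variable (k H) in
/-- The map `a ⊗ b ↦ a S(b)`. -/
def mulAntipode : H ⊗[k] H →ₗ[k] H :=
  LinearMap.mul' k H ∘ₗ (antipode k).lTensor H

@[simp]
theorem mulAntipode_tmul (a b : H) : mulAntipode k H (a ⊗ₜ[k] b) = a * antipode k b := by
  simp [mulAntipode]

theorem mulAntipode_comul (a : H) :
    mulAntipode k H (comul (R := k) a) = algebraMap k H (counit a) := by
  simp [mulAntipode]

/-- `𝐮 h = S²(h) 𝐮`. -/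
theorem uElement_mul (hΛ : ∀ h : H, Λ * h = counit (R := k) h • Λ) (h : H) :
    uElement k Λ * h = antipode k (antipode k h) * uElement k Λ := by
  have h1 (t : H ⊗[k] H) :
      antipodeMulSwap k H (t * (h ⊗ₜ[k] (1 : H))) = antipodeMulSwap k H t * h := by
    induction t with
    | zero => simp
    | tmul a b => simp [mul_assoc]
    | add a b ha hb => simp [add_mul, ha, hb]
  have h2 (t : H ⊗[k] H) : antipodeMulSwap k H (t * ((1 : H) ⊗ₜ[k] antipode k h)) =
      antipode k (antipode k h) * antipodeMulSwap k H t := by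
    induction t with
    | zero => simp
    | tmul a b => simp [mul_assoc, antipode_mul_antidistrib]
    | add a b ha hb => simp [add_mul, mul_add, ha, hb]
  rw [← antipodeMulSwap_comul, ← h1, comul_mul_tmul_one hΛ, h2]

end Integral

/-! ### Characters and the invertibility of `𝐮` -/

section Character

variable [AddCommGroup V] [Module k V]

theorem character_mul_comm (ρ : H →ₐ[k] Module.End k V) (a b : H) :
    character ρ (a * b) = character ρ (b * a) := by
  simp [character, LinearMap.trace_mul_comm k (ρ a) (ρ b)]

theorem character_dualRep [FiniteDimensional k V] (ρ : H →ₐ[k] Module.End k V) (h : H) :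
    character (dualRep ρ) h = character ρ (antipode k h) :=
  LinearMap.trace_transpose' (ρ (antipode k h))

/-- By cyclicity of the trace, `χ(S(Λ₍₂₎) Λ₍₁₎) = χ(Λ₍₁₎ S(Λ₍₂₎))`. -/
theorem character_uElement [FiniteDimensional k V] (ρ : H →ₐ[k] Module.End k V) (Λ : H) :
    character ρ (uElement k Λ) = counit (R := k) Λ * (Module.finrank k V : k) := by
  have h (t : H ⊗[k] H) :
      character ρ (antipodeMulSwap k H t) = character ρ (mulAntipode k H t) := by
    induction t with
    | zero => simp
    | tmul a b => simp [character_mul_comm ρ a]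
    | add a b ha hb => simp [ha, hb]
  rw [← antipodeMulSwap_comul, h, mulAntipode_comul]
  simp [character, Algebra.algebraMap_eq_smul_one]

end Character

/-- Over an algebraically closed field, an algebra surjects onto the endomorphisms of a
finite-dimensional simple module `M`, so `(dim M)² ≤ dim A`. -/
theorem sq_finrank_le_finrank_of_isSimpleModule {K A M : Type*} [Field K] [IsAlgClosed K] [Ring A]
    [Algebra K A] [FiniteDimensional K A] [AddCommGroup M] [Module K M] [Module A M]
    [IsScalarTower K A M] [FiniteDimensional K M] [IsSimpleModule A M] :
    Module.finrank K M ^ 2 ≤ Module.finrank K A := by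
  have hsurj : Function.Surjective (Algebra.lsmul K K M : A →ₐ[K] Module.End K M) := by
    intro f
    let b := Module.finBasis K M
    -- a `K`-linear map commutes with `End A M`, which consists of scalars
    let g : Module.End (Module.End A M) M :=
      { f with
        map_smul' := fun φ m ↦ by
          obtain ⟨c, rfl⟩ := (IsSimpleModule.algebraMap_end_bijective_of_isAlgClosed K
            (A := A) (V := M)).2 φ
          simp }
    classical
    obtain ⟨r, hr⟩ := jacobson_density g (Finset.univ.image b)
    refine ⟨r, b.ext fun i ↦ ?_⟩
    exact (hr (b i) (by simp)).symm
  have := LinearMap.finrank_le_finrank_of_surjective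
    (f := (Algebra.lsmul K K M : A →ₐ[K] Module.End K M).toLinearMap) hsurj
  rwa [Module.finrank_linearMap, ← sq] at this

/-- The kernel of left multiplication by `𝐮` is a left ideal, and it contains no simple left ideal
`I` because `𝐮` has trace `ε(Λ) dim I ≠ 0` on `I`. -/
theorem isUnit_uElement [IsAlgClosed k] [FiniteDimensional k H] [IsSemisimpleRing H]
    (p : ℕ) [CharP k p] (hp : Real.sqrt (Module.finrank k H : ℝ) < (p : ℝ))
    {Λ : H} (hΛ : IsLeftIntegral k Λ) (hΛ0 : Λ ≠ 0) : IsUnit (uElement k Λ) := by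
  have hε : counit (R := k) Λ ≠ 0 := fun h ↦ hΛ0 (hΛ.eq_zero_of_counit_eq_zero h)
  let K : Ideal H :=
    { LinearMap.ker (LinearMap.mulLeft k (uElement k Λ)) with
      smul_mem' := fun h x (hx : uElement k Λ * x = 0) ↦ by
        change uElement k Λ * (h * x) = 0
        rw [← mul_assoc, uElement_mul hΛ.mul_eq_counit_smul, mul_assoc, hx, mul_zero] }
  have hK (x : H) : x ∈ K ↔ uElement k Λ * x = 0 := Iff.rfl
  have hbot : K = ⊥ := by
    obtain h | ⟨I, hIK, hI⟩ := IsSemisimpleModule.eq_bot_or_exists_simple_le K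
    · exact h
    exfalso
    have : FiniteDimensional k I := inferInstanceAs
      (FiniteDimensional k (I.restrictScalars k))
    have : Nontrivial I := IsSimpleModule.nontrivial H I
    have hdim : Module.finrank k I < p := by
      have h1 : Module.finrank k I ^ 2 ≤ Module.finrank k H :=
        sq_finrank_le_finrank_of_isSimpleModule (A := H)
      have h2 : (Module.finrank k I : ℝ) ≤ Real.sqrt (Module.finrank k H : ℝ) :=
        Real.le_sqrt_of_sq_le (by exact_mod_cast h1)
      exact_mod_cast h2.trans_lt hp
    have hne : (Module.finrank k I : k) ≠ 0 := fun h ↦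
      Nat.not_dvd_of_pos_of_lt Module.finrank_pos hdim ((CharP.cast_eq_zero_iff k p _).mp h)
    refine mul_ne_zero hε hne ?_
    rw [← character_uElement (Algebra.lsmul k k I : H →ₐ[k] Module.End k I)]
    have h0 : (Algebra.lsmul k k I : H →ₐ[k] Module.End k I) (uElement k Λ) = 0 := by
      ext x
      exact (hK _).mp (hIK x.2)
    simp [character, h0]
  have hinj : Function.Injective (LinearMap.mulLeft k (uElement k Λ)) := by
    rw [injective_iff_map_eq_zero]
    intro x hx
    have : x ∈ K := hx
    rwa [hbot] at this
  obtain ⟨w, hw⟩ := (LinearMap.injective_iff_surjective.mp hinj) 1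
  exact IsUnit.of_mul_eq_one w hw

/-! ### The flip of the comultiplication of an integral -/

section Flip

variable {Λ : H}

/-- `a S(b)` applied to the flip of `Δ(Λ)` gives `S(𝐮)`, that is, `Λ₍₂₎ S(Λ₍₁₎) = S(𝐮)`, when
`S(Λ) = Λ`. -/
theorem mulAntipode_comm_comul (hS : antipode k Λ = Λ) :
    mulAntipode k H (TensorProduct.comm k H H (comul (R := k) Λ)) = antipode k (uElement k Λ) := by
  have h (t : H ⊗[k] H) : mulAntipode k H (TensorProduct.comm k H H
      (TensorProduct.map (antipode k) (antipode k) (TensorProduct.comm k H H t))) =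
      antipode k (antipodeMulSwap k H t) := by
    induction t with
    | zero => simp
    | tmul a b => simp [antipode_mul_antidistrib]
    | add a b ha hb => simp only [map_add, ha, hb]
  rw [← antipodeMulSwap_comul, ← h, ← comul_antipode, hS]

/-- `Λ₍₂₎ ⊗ Λ₍₁₎ S(𝐮) = Λ₍₁₎ ⊗ 𝐮 Λ₍₂₎`: both sides are equal to the product of the flip of `Δ(Λ)`
with `Δ(Λ)`. -/
theorem comm_comul_mul (hΛ : IsLeftIntegral k Λ) (hΛ' : ∀ h : H, Λ * h = counit (R := k) h • Λ)
    (hS : antipode k Λ = Λ) (hu : antipode k (antipode k (uElement k Λ)) = uElement k Λ) :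
    TensorProduct.comm k H H (comul (R := k) Λ) * ((1 : H) ⊗ₜ[k] antipode k (uElement k Λ)) =
      ((1 : H) ⊗ₜ[k] uElement k Λ) * comul (R := k) Λ := by
  have hflip (h : H) : TensorProduct.comm k H H (comul (R := k) Λ) * ((1 : H) ⊗ₜ[k] h) =
      TensorProduct.comm k H H (comul (R := k) Λ) * (antipode k h ⊗ₜ[k] (1 : H)) := by
    have := congr(Algebra.TensorProduct.comm k H H $(comul_mul_tmul_one hΛ' h))
    simp only [map_mul, Algebra.TensorProduct.comm_tmul] at this
    exact this
  have h1 (t : H ⊗[k] H) : t * comul (R := k) Λ = (mulAntipode k H t ⊗ₜ[k] (1 : H)) * comul (R := k) Λ := by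
    induction t with
    | zero => simp
    | tmul a b =>
      have : a ⊗ₜ[k] b = (a ⊗ₜ[k] (1 : H)) * ((1 : H) ⊗ₜ[k] b) := by simp
      rw [this, mul_assoc, hΛ.one_tmul_mul_comul, ← mul_assoc]
      simp
    | add a b ha hb => simp [add_mul, TensorProduct.add_tmul, ha, hb]
  have h2 (t : H ⊗[k] H) : TensorProduct.comm k H H (comul (R := k) Λ) * t =
      TensorProduct.comm k H H (comul (R := k) Λ) * (antipodeMulSwap k H t ⊗ₜ[k] (1 : H)) := by
    induction t with
    | zero => simp
    | tmul a b =>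
      have : a ⊗ₜ[k] b = ((1 : H) ⊗ₜ[k] b) * (a ⊗ₜ[k] (1 : H)) := by simp
      rw [this, ← mul_assoc, hflip, mul_assoc]
      simp
    | add a b ha hb => simp [mul_add, TensorProduct.add_tmul, ha, hb]
  rw [hΛ.one_tmul_mul_comul, ← mulAntipode_comm_comul hS, ← h1, h2 (comul (R := k) Λ), antipodeMulSwap_comul,
    hflip, mulAntipode_comm_comul hS, hu]

end Flip

/-! ### Sweedler powers -/

section SweedlerPower

/-- Reversing products and coproducts, `S` reverses the order of the factors of a convolution
power of a map that commutes with `S`, which leaves the power unchanged. -/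
theorem antipode_convPow_apply (f : H →ₗ[k] H) (hf : ∀ a, antipode k (f a) = f (antipode k a))
    (m : ℕ) (a : H) :
    antipode k ((toConv f ^ m) a) = (toConv f ^ m) (antipode k a) := by
  induction m generalizing a with
  | zero => simp [Algebra.algebraMap_eq_smul_one]
  | succ m ih =>
    rw [pow_succ, LinearMap.convMul_apply]
    rw [← pow_succ, pow_succ', LinearMap.convMul_apply, comul_antipode]
    induction comul (R := k) a using TensorProduct.induction_on with
    | zero => simp
    | tmul x y =>
      have := ih x
      simp [antipode_mul_antidistrib, hf, this]
    | add x y hx hy => simp only [map_add, hx, hy]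

theorem antipode_sweedlerPower (n : ℤ) (a : H) :
    antipode k (sweedlerPower k H n a) = sweedlerPower k H n (antipode k a) := by
  cases n with
  | ofNat m => exact antipode_convPow_apply LinearMap.id (fun _ ↦ rfl) m a
  | negSucc m => exact antipode_convPow_apply (antipode k) (fun _ ↦ rfl) (m + 1) a

/-- `P_n = id * P_{n-1} = P_{n-1} * id` for the convolution product. -/
theorem exists_sweedlerPower_eq_convMul (n : ℤ) : ∃ Q : H →ₗ[k] H,
    toConv (sweedlerPower k H n) = toConv LinearMap.id * toConv Q ∧
      toConv (sweedlerPower k H n) = toConv Q * toConv LinearMap.id := by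
  have h (m : ℕ) : ∃ Q : H →ₗ[k] H,
      toConv (antipode k : H →ₗ[k] H) ^ m = toConv LinearMap.id * toConv Q ∧
        toConv (antipode k : H →ₗ[k] H) ^ m = toConv Q * toConv LinearMap.id := by
    refine ⟨(toConv (antipode k : H →ₗ[k] H) ^ (m + 1)).ofConv, ?_, ?_⟩
    · rw [toConv_ofConv, pow_succ', ← mul_assoc, LinearMap.id_mul_antipode, one_mul]
    · rw [toConv_ofConv, pow_succ, mul_assoc, LinearMap.antipode_mul_id, mul_one]
  match n with
  | Int.ofNat 0 => simpa [sweedlerPower] using h 0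
  | Int.ofNat (m + 1) =>
    exact ⟨(toConv LinearMap.id ^ m).ofConv, pow_succ' _ _, pow_succ _ _⟩
  | Int.negSucc m => exact h (m + 1)

end SweedlerPower

/-! ### Indicators -/

section Indicator

variable [AddCommGroup V] [Module k V] {Λ : H}

/-- Moving `Λ₍₁₎` around the trace replaces `𝐮⁻¹` by `S(𝐮)⁻¹`. -/
theorem character_mul_sweedlerPower_eq (hΛ : IsLeftIntegral k Λ)
    (hΛ' : ∀ h : H, Λ * h = counit (R := k) h • Λ) (hS : antipode k Λ = Λ)
    (hu : antipode k (antipode k (uElement k Λ)) = uElement k Λ)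
    {u' v' : H} (hu' : u' * uElement k Λ = 1) (hv' : antipode k (uElement k Λ) * v' = 1)
    (ρ : H →ₐ[k] Module.End k V) (n : ℤ) :
    character ρ (u' * sweedlerPower k H n Λ) = character ρ (v' * sweedlerPower k H n Λ) := by
  obtain ⟨Q, hQ, hQ'⟩ := exists_sweedlerPower_eq_convMul (k := k) (H := H) n
  -- `Λ₍₁₎ ⊗ Λ₍₂₎ = 𝐮 Λ₍₂₎ S(𝐮)⁻¹ ⊗ Λ₍₁₎`
  have hδ : comul (R := k) Λ = (uElement k Λ ⊗ₜ[k] (1 : H)) *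
      TensorProduct.comm k H H (comul (R := k) Λ) * (v' ⊗ₜ[k] (1 : H)) := by
    have h := congr(Algebra.TensorProduct.comm k H H ($(comm_comul_mul hΛ hΛ' hS hu)) *
      (v' ⊗ₜ[k] (1 : H)))
    simp only [map_mul, Algebra.TensorProduct.comm_tmul, mul_assoc,
      Algebra.TensorProduct.tmul_mul_tmul, hv', mul_one, ← Algebra.TensorProduct.one_def] at h
    rw [mul_assoc]
    exact ((TensorProduct.comm k H H).symm_apply_apply _).symm.trans h
  have key (t : H ⊗[k] H) :
      character ρ (u' * LinearMap.mul' k H (TensorProduct.map LinearMap.id Q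
        ((uElement k Λ ⊗ₜ[k] (1 : H)) * TensorProduct.comm k H H t * (v' ⊗ₜ[k] (1 : H))))) =
      character ρ (v' * LinearMap.mul' k H (TensorProduct.map Q LinearMap.id t)) := by
    induction t with
    | zero => simp
    | tmul a b =>
      have h1 : u' * (uElement k Λ * b * v' * Q a) = b * (v' * Q a) := by
        rw [mul_assoc, mul_assoc, ← mul_assoc u', hu', one_mul]
      have h2 : v' * (Q a * b) = v' * Q a * b := (mul_assoc _ _ _).symm
      simp [h1, h2, character_mul_comm ρ b]
    | add a b ha hb => simp only [map_add, mul_add, add_mul, ha, hb]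
  have h1 : sweedlerPower k H n Λ =
      LinearMap.mul' k H (TensorProduct.map LinearMap.id Q (comul (R := k) Λ)) := congr($hQ Λ)
  have h2 : sweedlerPower k H n Λ =
      LinearMap.mul' k H (TensorProduct.map Q LinearMap.id (comul (R := k) Λ)) := congr($hQ' Λ)
  conv_lhs => rw [h1, hδ, key]
  rw [h2]

end Indicator

end HopfIndicator

theorem mainTheorem5 {k H : Type*} [Field k] [IsAlgClosed k] [Ring H] [HopfAlgebra k H]
    [FiniteDimensional k H] [IsSemisimpleRing H]
    (p : ℕ) [CharP k p] (hp : Real.sqrt (Module.finrank k H : ℝ) < (p : ℝ))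
    (Λ : H) (hΛ : HopfIndicator.IsLeftIntegral k Λ) (hΛ0 : Λ ≠ 0) :
    IsUnit (HopfIndicator.uElement k Λ) ∧
      ∀ {V : Type*} [AddCommGroup V] [Module k V] [FiniteDimensional k V]
        (ρ : H →ₐ[k] Module.End k V) (n : ℤ),
        HopfIndicator.fsIndicator Λ ρ n =
          HopfIndicator.fsIndicator Λ (HopfIndicator.dualRep ρ) n := by
  have hunit := HopfIndicator.isUnit_uElement p hp hΛ hΛ0
  refine ⟨hunit, fun ρ n ↦ ?_⟩
  have hΛ' := hΛ.mul_eq_counit_smul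
  have hcomm := HopfIndicator.uElement_mul hΛ'
  -- `S²` is conjugation by `𝐮`, so `S` is bijective
  have hSinj : Function.Injective (HopfAlgebra.antipode k : H →ₗ[k] H) := by
    rw [injective_iff_map_eq_zero]
    intro x hx
    have h := hcomm x
    rwa [hx, map_zero, zero_mul, hunit.mul_right_eq_zero] at h
  have hS := hΛ.antipode_eq (LinearMap.injective_iff_surjective.mp hSinj)
  have hu : HopfAlgebra.antipode k (HopfAlgebra.antipode k (HopfIndicator.uElement k Λ)) =
      HopfIndicator.uElement k Λ := (hunit.mul_left_injective (hcomm _)).symm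
  have hv : HopfAlgebra.antipode k (HopfIndicator.uElement k Λ) *
      HopfAlgebra.antipode k (Ring.inverse (HopfIndicator.uElement k Λ)) = 1 := by
    rw [← HopfAlgebra.antipode_mul_antidistrib, Ring.inverse_mul_cancel _ hunit,
      HopfAlgebra.antipode_one]
  rw [HopfIndicator.fsIndicator, HopfIndicator.fsIndicator, HopfIndicator.character_dualRep,
    HopfAlgebra.antipode_mul_antidistrib, HopfIndicator.antipode_sweedlerPower, hS,
    HopfIndicator.character_mul_comm ρ (HopfIndicator.sweedlerPower k H n Λ)]
  exact HopfIndicator.character_mul_sweedlerPower_eq hΛ hΛ' hS hu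
    (Ring.inverse_mul_cancel _ hunit) hv ρ n
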